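/- Let $\mathcal S$ and $\Theta$ be finite sets, and for every $s\in\mathcal S$ let $\mathcal A(s)$ and $\mathcal D(s)$ be finite non-empty sets (the actions available to the attacker and to the defender in state $s$). For $s\in\mathcal S$, $a\in\mathcal A(s)$, $d\in\mathcal D(s)$ let $\mathcal T(\cdot\mid s,a,d)\in\Delta(\mathcal S)$ be a transition law and let $R(s,a,d,s';\vartheta)\in\mathbb R$, $s'\in\mathcal S$, $\vartheta\in\Theta$, be a reward; let $\gamma\in[0,1)$. In the N-CIRL game the intent parameter $\theta\in\Theta$ is drawn once and told to the attacker only. At each stage $t\ge 0$ both players know the current state $s_t$ and choose simultaneously $a_t\in\mathcal A(s_t)$ and $d_t\in\mathcal D(s_t)$; the next state $s_{t+1}$ is drawn from $\mathcal T(\cdot\mid s_t,a_t,d_t)$, and $s_{t+1},a_t,d_t$ are told to both players. Rewards are not observed. A behavioral strategy $\sigma^A$ of the attacker assigns to every $(s_0,\theta,a_0,d_0,\dots,a_{t-1},d_{t-1},s_t)$ (all states $s_0,\dots,s_t$ included), $t\ge0$, an element of $\Delta(\mathcal A(s_t))$; a behavioral strategy $\sigma^D$ of the defender assigns to every $(s_0,a_0,d_0,\dots,a_{t-1},d_{t-1},s_t)$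 an element of $\Delta(\mathcal D(s_t))$. The value function $v:\mathcal S\times\Delta(\Theta)\to\mathbb R$ is \[ v(s,b)=\max_{\sigma^A}\min_{\sigma^D}\ \mathbb E\Big[\sum_{t\ge0}\gamma^tR(s_t,a_t,d_t,s_{t+1};\theta)\,\Big|\,s_0=s,\ \theta\sim b\Big]. \] One-stage strategies $\bar\pi^A$, $\bar\pi^D$ assign to every $(s,\vartheta)\in\mathcal S\times\Theta$ an element $\bar\pi^A(\cdot\mid s,\vartheta)$ of $\Delta(\mathcal A(s))$ and to every $s\in\mathcal S$ an element $\bar\pi^D(\cdot\mid s)$ of $\Delta(\mathcal D(s))$. Then the maxima and minima in the definition of $v$ are attained, and for all $s\in\mathcal S$ and $b\in\Delta(\Theta)$ \[ v(s,b)=[Gv](s,b)=\max_{\bar\pi^A}\min_{\bar\pi^D}\big\{g_{\bar\pi^A,\bar\pi^D}(s,b)+\gamma V_{\bar\pi^A,\bar\pi^D}(v;s,b)\big\}, \] where these maxima and minima are attained too, and where \[ g_{\bar\pi^A,\bar\pi^D}(s,b)=\sum_{a,d,s',\vartheta}b(\vartheta)\,\bar\pi^A(a\mid s,\vartheta)\,\bar\pi^D(d\mid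 s)\,\mathcal T(s'\mid s,a,d)\,R(s,a,d,s';\vartheta), \] \[ V_{\bar\pi^A,\bar\pi^D}(v;s,b)=\sum_{a,d,s',\vartheta}b(\vartheta)\,\bar\pi^A(a\mid s,\vartheta)\,\bar\pi^D(d\mid s)\,\mathcal T(s'\mid s,a,d)\,v(s',b'), \] \[ b'(\vartheta)=\frac{\bar\pi^A(a\mid s,\vartheta)\,b(\vartheta)}{\sum_{\vartheta'\in\Theta}\bar\pi^A(a\mid s,\vartheta')\,b(\vartheta')} \] is the Bayesian posterior after the attacker's action $a$ (where the denominator is zero, all summands that involve $b'$ have weight zero, and $b'\in\Delta(\Theta)$ may be chosen arbitrarily, for instance $b'=b$). -/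

import Mathlib

open MeasureTheory ProbabilityTheory

namespace NCIRL

/-- Data of one stage of play: the public state and the two actions chosen there, which have to
be available at that state. -/
@[ext]
structure Stage {S : Type*} (A D : S → Type*) where
  /-- the state `s` of the stage -/
  state : S
  /-- the attacker's action `a ∈ A(s)` -/
  att : A state
  /-- the defender's action `d ∈ D(s)` -/
  dfn : D state

/-- Stages form a finite type; they carry the discrete sigma-algebra. -/
instance {S : Type*} (A D : S → Type*) : MeasurableSpace (Stage A D) := ⊤

instance {S : Type*} (A D : S → Type*) : DiscreteMeasurableSpace (Stage A D) := ⟨fun _ => trivial⟩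

instance {S : Type*} (A D : S → Type*) [Finite S] [∀ s, Finite (A s)] [∀ s, Finite (D s)] :
    Finite (Stage A D) :=
  Finite.of_injective (fun x : Stage A D => (⟨x.state, x.att, x.dfn⟩ : Σ s, A s × D s)) (by
    rintro ⟨s, a, d⟩ ⟨s', a', d'⟩ h
    simp only [Sigma.mk.injEq] at h
    obtain ⟨rfl, h⟩ := h
    simpa using h)

/-- The primitives of the game: the transition law `T(· ∣ s, a, d)`, the reward
`R(s, a, d, s'; θ)` of the attacker (a cost of the defender) and the discount factor
`γ ∈ [0, 1)`.  `A s` and `D s` are the sets of actions available at the state `s`; constant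
families give state-independent action sets. -/
structure Game (S Θ : Type*) (A D : S → Type*) [Fintype S] where
  T : (s : S) → A s → D s → stdSimplex ℝ S
  R : (s : S) → A s → D s → S → Θ → ℝ
  γ : ℝ
  γ_nonneg : 0 ≤ γ
  γ_lt_one : γ < 1

/-- Behavioral strategies of the attacker.  The list holds the past stages
`(s₀, a₀, d₀), …, (sₜ₋₁, aₜ₋₁, dₜ₋₁)` in chronological order (so its length is the time `t`),
followed by the current state `sₜ` and by the intent parameter `θ`, which the attacker knows. -/
abbrev AttackerStrategy {S : Type*} (Θ : Type*) (A D : S → Type*) [∀ s, Fintype (A s)] :=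
  List (Stage A D) → (s : S) → Θ → stdSimplex ℝ (A s)

/-- Behavioral strategies of the defender, who sees the same except for the intent parameter. -/
abbrev DefenderStrategy {S : Type*} (A D : S → Type*) [∀ s, Fintype (D s)] :=
  List (Stage A D) → (s : S) → stdSimplex ℝ (D s)

/-- One-stage strategies of the attacker. -/
abbrev AttackerOneStage {S : Type*} (Θ : Type*) (A : S → Type*) [∀ s, Fintype (A s)] :=
  (s : S) → Θ → stdSimplex ℝ (A s)

/-- One-stage strategies of the defender. -/
abbrev DefenderOneStage {S : Type*} (D : S → Type*) [∀ s, Fintype (D s)] :=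
  (s : S) → stdSimplex ℝ (D s)

section Law

variable {S : Type*} {A D : S → Type*} [Fintype S] [∀ s, Fintype (A s)] [∀ s, Fintype (D s)]

/-- The law of a stage whose state has the law `μ`, and where, given the state `s`, the actions
are drawn independently from `α s` and `δ s`. -/
noncomputable def stageLaw (μ : stdSimplex ℝ S) (α : (s : S) → stdSimplex ℝ (A s))
    (δ : (s : S) → stdSimplex ℝ (D s)) : Measure (Stage A D) :=
  ∑ s, ∑ a, ∑ d, ENNReal.ofReal (μ.1 s * (α s).1 a * (δ s).1 d) •
    Measure.dirac (⟨s, a, d⟩ : Stage A D)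

instance (μ : stdSimplex ℝ S) (α : (s : S) → stdSimplex ℝ (A s))
    (δ : (s : S) → stdSimplex ℝ (D s)) : IsProbabilityMeasure (stageLaw μ α δ) := by
  constructor
  have hμ := μ.2
  have hα := fun s => (α s).2
  have hδ := fun s => (δ s).2
  have h1 : ∀ s a d, 0 ≤ μ.1 s * (α s).1 a * (δ s).1 d := fun s a d =>
    mul_nonneg (mul_nonneg (hμ.1 s) ((hα s).1 a)) ((hδ s).1 d)
  have h2 : ∀ s a, 0 ≤ ∑ d, μ.1 s * (α s).1 a * (δ s).1 d := fun s a =>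
    Finset.sum_nonneg fun d _ => h1 s a d
  have h3 : ∀ s, 0 ≤ ∑ a, ∑ d, μ.1 s * (α s).1 a * (δ s).1 d := fun s =>
    Finset.sum_nonneg fun a _ => h2 s a
  simp only [stageLaw, Measure.coe_finsetSum, Finset.sum_apply, Measure.smul_apply,
    measure_univ, smul_eq_mul, mul_one]
  simp only [← ENNReal.ofReal_sum_of_nonneg (fun d _ => h1 _ _ d),
    ← ENNReal.ofReal_sum_of_nonneg (fun a _ => h2 _ a),
    ← ENNReal.ofReal_sum_of_nonneg (fun s _ => h3 s)]
  simp only [← Finset.mul_sum, (hδ _).2, mul_one, (hα _).2, hμ.2, ENNReal.ofReal_one]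

/-- The list `[x₀, …, xₙ]` of the stages up to time `n`. -/
def pastList {n : ℕ} (x : Finset.Iic n → Stage A D) : List (Stage A D) :=
  List.ofFn fun i : Fin (n + 1) => x ⟨i, Finset.mem_Iic.2 (Nat.lt_succ_iff.1 i.2)⟩

end Law

namespace Game

variable {S Θ : Type*} {A D : S → Type*} [Fintype S] [∀ s, Fintype (A s)] [∀ s, Fintype (D s)]

/-- The conditional law of stage `n + 1` given the stages `0, …, n`, for the intent parameter
`ϑ`: the next state is drawn from the transition law, and the players then act according to
their behavioral strategies. -/
noncomputable def stepKernel (G : Game S Θ A D) (ϑ : Θ) (σA : AttackerStrategy Θ A D)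
    (σD : DefenderStrategy A D) (n : ℕ) : Kernel (Finset.Iic n → Stage A D) (Stage A D) :=
  Kernel.ofFunOfCountable fun x =>
    stageLaw
      (G.T (x ⟨n, Finset.mem_Iic.2 le_rfl⟩).state (x ⟨n, Finset.mem_Iic.2 le_rfl⟩).att
        (x ⟨n, Finset.mem_Iic.2 le_rfl⟩).dfn)
      (fun s => σA (pastList x) s ϑ) (fun s => σD (pastList x) s)

instance (G : Game S Θ A D) (ϑ : Θ) (σA : AttackerStrategy Θ A D) (σD : DefenderStrategy A D)
    (n : ℕ) : IsMarkovKernel (G.stepKernel ϑ σA σD n) :=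
  ⟨fun _ => inferInstanceAs (IsProbabilityMeasure (stageLaw _ _ _))⟩

open Classical in
/-- The law of the infinite play when `s₀ = s`, the intent parameter is `ϑ` and the players use
the behavioral strategies `σA` and `σD`. -/
noncomputable def playLaw (G : Game S Θ A D) (s : S) (ϑ : Θ) (σA : AttackerStrategy Θ A D)
    (σD : DefenderStrategy A D) : Measure (ℕ → Stage A D) :=
  Kernel.trajMeasure (X := fun _ => Stage A D)
    (stageLaw ⟨Pi.single s 1, single_mem_stdSimplex ℝ s⟩ (fun s' => σA [] s' ϑ)
      (fun s' => σD [] s'))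
    (G.stepKernel ϑ σA σD)

/-- The discounted accumulated reward `∑ₜ γᵗ R(sₜ, aₜ, dₜ, sₜ₊₁; ϑ)` along a play. -/
noncomputable def discountedReward (G : Game S Θ A D) (ϑ : Θ) (ω : ℕ → Stage A D) : ℝ :=
  ∑' t : ℕ, G.γ ^ t * G.R (ω t).state (ω t).att (ω t).dfn (ω (t + 1)).state ϑ

variable [Fintype Θ]

/-- The expected discounted accumulated reward when `s₀ = s` and `θ` is drawn from `b`. -/
noncomputable def payoff (G : Game S Θ A D) (s : S) (b : stdSimplex ℝ Θ)
    (σA : AttackerStrategy Θ A D) (σD : DefenderStrategy A D) : ℝ :=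
  ∑ ϑ, b.1 ϑ * ∫ ω, G.discountedReward ϑ ω ∂(G.playLaw s ϑ σA σD)

/-- The primal value function: the maximin of the payoff over behavioral strategies. -/
noncomputable def value (G : Game S Θ A D) (s : S) (b : stdSimplex ℝ Θ) : ℝ :=
  ⨆ σA : AttackerStrategy Θ A D, ⨅ σD : DefenderStrategy A D, G.payoff s b σA σD

end Game

section Backup

variable {S Θ : Type*} {A D : S → Type*} [Fintype Θ] [∀ s, Fintype (A s)] [∀ s, Fintype (D s)]

open Classical in
/-- The Bayesian posterior `b'(ϑ) = πA(a ∣ s, ϑ) b(ϑ) / ∑ ϑ', πA(a ∣ s, ϑ') b(ϑ')` after the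
attacker's action `a`.  If `a` has probability zero, there is no posterior, and `b` is kept. -/
noncomputable def posterior (πA : AttackerOneStage Θ A) (s : S) (b : stdSimplex ℝ Θ) (a : A s) :
    stdSimplex ℝ Θ :=
  if h : ∑ ϑ', (πA s ϑ').1 a * b.1 ϑ' = 0 then b else
    ⟨fun ϑ => (πA s ϑ).1 a * b.1 ϑ / ∑ ϑ', (πA s ϑ').1 a * b.1 ϑ',
      fun ϑ => div_nonneg (mul_nonneg ((πA s ϑ).2.1 a) (b.2.1 ϑ))
        (Finset.sum_nonneg fun ϑ' _ => mul_nonneg ((πA s ϑ').2.1 a) (b.2.1 ϑ')),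
      by rw [← Finset.sum_div, div_self h]⟩

variable [Fintype S]

/-- The expected instantaneous reward `g` of a one-stage strategy profile. -/
noncomputable def Game.instReward (G : Game S Θ A D) (πA : AttackerOneStage Θ A)
    (πD : DefenderOneStage D) (s : S) (b : stdSimplex ℝ Θ) : ℝ :=
  ∑ a, ∑ d, ∑ s', ∑ ϑ,
    b.1 ϑ * (πA s ϑ).1 a * (πD s).1 d * (G.T s a d).1 s' * G.R s a d s' ϑ

/-- The expected value `V(v; s, b)` of the continuation game under a one-stage strategy profile,
when continuation is worth `v(s', b')`. -/
noncomputable def Game.contValue (G : Game S Θ A D) (πA : AttackerOneStage Θ A)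
    (πD : DefenderOneStage D) (v : S → stdSimplex ℝ Θ → ℝ) (s : S) (b : stdSimplex ℝ Θ) : ℝ :=
  ∑ a, ∑ d, ∑ s', ∑ ϑ,
    b.1 ϑ * (πA s ϑ).1 a * (πD s).1 d * (G.T s a d).1 s' * v s' (posterior πA s b a)

/-- The payoff of the single-stage game at `(s, b)` with continuation worth `v`. -/
noncomputable def Game.stagePayoff (G : Game S Θ A D) (v : S → stdSimplex ℝ Θ → ℝ) (s : S)
    (b : stdSimplex ℝ Θ) (πA : AttackerOneStage Θ A) (πD : DefenderOneStage D) : ℝ :=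
  G.instReward πA πD s b + G.γ * G.contValue πA πD v s b

/-- The primal value backup operator `[Gv](s, b)`: the maximin of the single-stage game. -/
noncomputable def Game.backup (G : Game S Θ A D) (v : S → stdSimplex ℝ Θ → ℝ) (s : S)
    (b : stdSimplex ℝ Θ) : ℝ :=
  ⨆ πA : AttackerOneStage Θ A, ⨅ πD : DefenderOneStage D, G.stagePayoff v s b πA πD

end Backup

/-- `c = max_x min_y f x y`, where the minimum over `y` is attained for every `x` and the
maximum over `x` is attained as well. -/
def IsMaxMin {X Y : Type*} (f : X → Y → ℝ) (c : ℝ) : Prop :=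
  ∃ m : X → ℝ, (∀ x, IsLeast (Set.range (f x)) (m x)) ∧ IsGreatest (Set.range m) c

end NCIRL

/-! Replace beliefs by unnormalised weights `w` on the intent parameters. The payoff is linear in
`w`, and conditioning on the attacker's action `a` multiplies `w ϑ` by the probability of `a`; no
division occurs. Splitting off the first stage (`Game.playValue_eq`, `Game.weightedPayoff_eq`)
writes the payoff as a nonnegative combination, over `a`, `d`, `s'`, of rewards and of continuation
payoffs with the new weights, which depend on the attacker's first move but not on the defender's.

The maximin is positively homogeneous in the weights (`Game.weightedValue_smul`), so the mass of `a`
times the value at the posterior is the value at the new weights (`Game.sum_mul_value_posterior`).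
Thus the stage payoff has the same form as the full payoff, with continuation payoffs replaced by
their maximin.

In `Game.value_eq_backup`, continuation strategies are chosen separately for each first stage and
next state and glued together. Gluing optimal attackers gives one inequality; gluing the defender's
replies to a fixed attacker gives the other. No exchange of max and min is involved. All extrema are
attained by compactness: strategy spaces are products of simplices, and discounting makes the payoff
a uniform limit of continuous finite-horizon payoffs. -/

namespace NCIRL

/-! ### Expectations over a single stage -/

section Integrals

variable {S : Type*} {A D : S → Type*} [Fintype S] [∀ s, Fintype (A s)] [∀ s, Fintype (D s)]

/-- The expectation of `h a d` for actions drawn independently from `α` and `δ`. -/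
noncomputable def actionAvg {X Y : Type*} [Fintype X] [Fintype Y] (α : stdSimplex ℝ X)
    (δ : stdSimplex ℝ Y) (h : X → Y → ℝ) : ℝ :=
  ∑ a, ∑ d, α.1 a * δ.1 d * h a d

lemma sum_eq_one {X : Type*} [Fintype X] (α : stdSimplex ℝ X) : ∑ a, α.1 a = 1 := α.2.2

lemma coe_nonneg {X : Type*} [Fintype X] (α : stdSimplex ℝ X) (a : X) : 0 ≤ α.1 a := α.2.1 a

lemma actionAvg_eq {X Y : Type*} [Fintype X] [Fintype Y] (α : stdSimplex ℝ X)
    (δ : stdSimplex ℝ Y) (h : X → Y → ℝ) :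
    actionAvg α δ h = ∑ a, α.1 a * ∑ d, δ.1 d * h a d := by
  simp only [actionAvg, Finset.mul_sum, mul_assoc]

lemma integral_stageLaw (μ : stdSimplex ℝ S) (α : (s : S) → stdSimplex ℝ (A s))
    (δ : (s : S) → stdSimplex ℝ (D s)) (f : Stage A D → ℝ) :
    ∫ x, f x ∂(stageLaw μ α δ) =
      ∑ s, μ.1 s * actionAvg (α s) (δ s) fun a d => f ⟨s, a, d⟩ := by
  have hint : ∀ (m : Measure (Stage A D)) [IsFiniteMeasure m], Integrable f m :=
    fun m _ => Integrable.of_finite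
  have h0 : ∀ s a d, 0 ≤ μ.1 s * (α s).1 a * (δ s).1 d := fun s a d =>
    mul_nonneg (mul_nonneg (coe_nonneg _ _) (coe_nonneg _ _)) (coe_nonneg _ _)
  have h1 : ∀ s a d, Integrable f (ENNReal.ofReal (μ.1 s * (α s).1 a * (δ s).1 d) •
      Measure.dirac (⟨s, a, d⟩ : Stage A D)) := fun s a d =>
    (hint _).smul_measure ENNReal.ofReal_ne_top
  rw [stageLaw, integral_finsetSum_measure fun s _ => integrable_finsetSum_measure.2 fun a _ =>
    integrable_finsetSum_measure.2 fun d _ => h1 s a d]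
  refine Finset.sum_congr rfl fun s _ => ?_
  rw [integral_finsetSum_measure fun a _ => integrable_finsetSum_measure.2 fun d _ => h1 s a d,
    actionAvg, Finset.mul_sum]
  refine Finset.sum_congr rfl fun a _ => ?_
  rw [integral_finsetSum_measure fun d _ => h1 s a d, Finset.mul_sum]
  refine Finset.sum_congr rfl fun d _ => ?_
  rw [integral_smul_measure, integral_dirac, ENNReal.toReal_ofReal (h0 s a d), smul_eq_mul]
  ring

end Integrals

/-! ### From the trajectory measure to finite recursive sums -/

section Prefix

variable {S Θ : Type*} {A D : S → Type*}

/-- The continuation after the stage `x` of a strategy, whatever it prescribes at each history. -/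
def shift {Z : S → Type*} (x : Stage A D) (σ : List (Stage A D) → (s : S) → Z s) :
    List (Stage A D) → (s : S) → Z s :=
  fun l => σ (x :: l)

lemma getLastD_pastList {n : ℕ} (z : Finset.Iic n → Stage A D) (x₀ : Stage A D) :
    (pastList z).getLastD x₀ = z ⟨n, Finset.mem_Iic.2 le_rfl⟩ := by
  rw [pastList, List.ofFn_succ_last, List.getLastD_concat]
  rfl

lemma pastList_frestrictLe_succ (n : ℕ) (ω : ℕ → Stage A D) :
    pastList (Preorder.frestrictLe (π := fun _ => Stage A D) (n + 1) ω) =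
      pastList (Preorder.frestrictLe (π := fun _ => Stage A D) n ω) ++ [ω (n + 1)] := by
  rw [pastList, List.ofFn_succ_last]
  rfl

lemma measurable_comp_pastList  [Finite S] [∀ s, Finite (A s)] [∀ s, Finite (D s)]
    (n : ℕ) (f : List (Stage A D) → ℝ) :
    Measurable fun ω : ℕ → Stage A D =>
      f (pastList (Preorder.frestrictLe (π := fun _ => Stage A D) n ω)) :=
  (measurable_of_countable fun z : Finset.Iic n → Stage A D => f (pastList z)).comp
    (Preorder.measurable_frestrictLe n)

variable [Fintype S] [∀ s, Fintype (A s)] [∀ s, Fintype (D s)]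

/-- The expectation of `f [x₀, …, xₙ]` over the stages up to time `n` of the play from `s`. -/
noncomputable def Game.prefixExp (G : Game S Θ A D) (ϑ : Θ) :
    ℕ → S → AttackerStrategy Θ A D → DefenderStrategy A D → (List (Stage A D) → ℝ) → ℝ
  | 0, s, σA, σD, f => actionAvg (σA [] s ϑ) (σD [] s) fun a d => f [⟨s, a, d⟩]
  | n + 1, s, σA, σD, f => actionAvg (σA [] s ϑ) (σD [] s) fun a d => ∑ s', (G.T s a d).1 s' *
      G.prefixExp ϑ n s' (shift ⟨s, a, d⟩ σA) (shift ⟨s, a, d⟩ σD) fun l => f (⟨s, a, d⟩ :: l)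

/-- The expectation of `f (l ++ [x])` over the stage `x` that follows the past `l`; the stage
`x₀` takes the place of the last one when `l` is empty. -/
noncomputable def Game.nextExp (G : Game S Θ A D) (ϑ : Θ) (σA : AttackerStrategy Θ A D)
    (σD : DefenderStrategy A D) (f : List (Stage A D) → ℝ) (x₀ : Stage A D)
    (l : List (Stage A D)) : ℝ :=
  ∑ s', (G.T (l.getLastD x₀).state (l.getLastD x₀).att (l.getLastD x₀).dfn).1 s' *
    actionAvg (σA l s' ϑ) (σD l s') fun a d => f (l ++ [⟨s', a, d⟩])

lemma Game.nextExp_cons (G : Game S Θ A D) (ϑ : Θ) (σA : AttackerStrategy Θ A D)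
    (σD : DefenderStrategy A D) (f : List (Stage A D) → ℝ) (x₀ x : Stage A D)
    (l : List (Stage A D)) :
    G.nextExp ϑ σA σD f x₀ (x :: l) =
      G.nextExp ϑ (shift x σA) (shift x σD) (fun l => f (x :: l)) x l := by
  have h : (x :: l).getLastD x₀ = l.getLastD x := List.getLastD_cons
  unfold Game.nextExp
  rw [h]
  rfl

/-- `Game.prefixExp` recurses on the first stage, whereas the trajectory measure is built by
appending a last one; this reconciles the two. The lists that occur are nonempty, so `x₀` is
arbitrary. -/
lemma Game.prefixExp_succ (G : Game S Θ A D) (ϑ : Θ) (n : ℕ) (s : S)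
    (σA : AttackerStrategy Θ A D) (σD : DefenderStrategy A D) (f : List (Stage A D) → ℝ)
    (x₀ : Stage A D) :
    G.prefixExp ϑ (n + 1) s σA σD f = G.prefixExp ϑ n s σA σD (G.nextExp ϑ σA σD f x₀) := by
  induction n generalizing s σA σD f x₀ with
  | zero =>
    simp only [Game.prefixExp, Game.nextExp_cons]
    rfl
  | succ n ih =>
    rw [Game.prefixExp, Game.prefixExp]
    congr 1
    ext a d
    refine Finset.sum_congr rfl fun s' _ => ?_
    -- The first stage serves as the default for its own tail, as in `Game.nextExp_cons`.
    rw [ih _ _ _ _ ⟨s, a, d⟩]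
    simp only [Game.nextExp_cons]

lemma integral_stepKernel (G : Game S Θ A D) (ϑ : Θ) (σA : AttackerStrategy Θ A D)
    (σD : DefenderStrategy A D) (n : ℕ) (f : List (Stage A D) → ℝ) (x₀ : Stage A D)
    (z : Finset.Iic n → Stage A D) :
    ∫ y, f (pastList z ++ [y]) ∂(G.stepKernel ϑ σA σD n z) =
      G.nextExp ϑ σA σD f x₀ (pastList z) := by
  rw [Game.nextExp, getLastD_pastList]
  exact integral_stageLaw _ _ _ _

instance (G : Game S Θ A D) (s : S) (ϑ : Θ) (σA : AttackerStrategy Θ A D)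
    (σD : DefenderStrategy A D) : IsProbabilityMeasure (G.playLaw s ϑ σA σD) := by
  unfold Game.playLaw
  infer_instance

lemma Game.map_frestrictLe_compProd_playLaw (G : Game S Θ A D) (s : S) (ϑ : Θ)
    (σA : AttackerStrategy Θ A D) (σD : DefenderStrategy A D) (n : ℕ) :
    (G.playLaw s ϑ σA σD).map (Preorder.frestrictLe (π := fun _ => Stage A D) n) ⊗ₘ
        G.stepKernel ϑ σA σD n =
      (G.playLaw s ϑ σA σD).map
        fun ω => (Preorder.frestrictLe (π := fun _ => Stage A D) n ω, ω (n + 1)) :=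
  Kernel.map_frestrictLe_trajMeasure_compProd_eq_map_trajMeasure (X := fun _ => Stage A D)

open Classical in
lemma Game.map_zero_playLaw (G : Game S Θ A D) (s : S) (ϑ : Θ)
    (σA : AttackerStrategy Θ A D) (σD : DefenderStrategy A D) :
    (G.playLaw s ϑ σA σD).map (fun ω => ω 0) =
      stageLaw ⟨Pi.single s 1, single_mem_stdSimplex ℝ s⟩ (fun s' => σA [] s' ϑ)
        (fun s' => σD [] s') := by
  have h : (fun ω : ℕ → Stage A D => ω 0) =
      (MeasurableEquiv.piUnique fun _ : Finset.Iic 0 => Stage A D) ∘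
        Preorder.frestrictLe (π := fun _ => Stage A D) 0 := rfl
  -- The partial trajectory from time 0 to time 0 is the identity kernel, so only the initial law
  -- remains.
  rw [h, ← Measure.map_map (by fun_prop) (by fun_prop), Game.playLaw, Kernel.trajMeasure,
    Measure.map_comp _ _ (by fun_prop), Kernel.traj_map_frestrictLe, Kernel.partialTraj_self,
    Measure.id_comp]
  exact MeasurableEquiv.map_map_symm _

/-- Induction on the horizon: disintegrating along the step kernel integrates out the last stage.
This turns finite-horizon integrals into finite sums. -/
theorem Game.integral_pastList (G : Game S Θ A D) (x₀ : Stage A D) (s : S) (ϑ : Θ)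
    (σA : AttackerStrategy Θ A D) (σD : DefenderStrategy A D) (n : ℕ)
    (f : List (Stage A D) → ℝ) :
    ∫ ω, f (pastList (Preorder.frestrictLe (π := fun _ => Stage A D) n ω))
        ∂(G.playLaw s ϑ σA σD) = G.prefixExp ϑ n s σA σD f := by
  classical
  induction n generalizing f with
  | zero =>
    have h : ∀ ω : ℕ → Stage A D,
        f (pastList (Preorder.frestrictLe (π := fun _ => Stage A D) 0 ω)) = f [ω 0] :=
      fun ω => rfl
    simp only [h]
    rw [← integral_map (φ := fun ω : ℕ → Stage A D => ω 0) (f := fun x => f [x])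
      (measurable_pi_apply 0).aemeasurable (measurable_of_countable _).aestronglyMeasurable, G.map_zero_playLaw,
      integral_stageLaw, Finset.sum_eq_single s]
    · simp [Game.prefixExp]
    · intro s' _ hs'
      simp [hs']
    · simp
  | succ n ih =>
    rw [G.prefixExp_succ ϑ n s σA σD f x₀, ← ih]
    simp only [pastList_frestrictLe_succ]
    have hm : Measurable fun p : (Finset.Iic n → Stage A D) × Stage A D =>
      f (pastList p.1 ++ [p.2]) := measurable_of_countable _
    have hφ : Measurable fun ω : ℕ → Stage A D =>
      (Preorder.frestrictLe (π := fun _ => Stage A D) n ω, ω (n + 1)) := by fun_prop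
    have hi : IsProbabilityMeasure ((G.playLaw s ϑ σA σD).map
      (Preorder.frestrictLe (π := fun _ => Stage A D) n)) :=
      Measure.isProbabilityMeasure_map (by fun_prop)
    rw [← integral_map (f := fun p : (Finset.Iic n → Stage A D) × Stage A D =>
      f (pastList p.1 ++ [p.2])) hφ.aemeasurable hm.aestronglyMeasurable,
      ← G.map_frestrictLe_compProd_playLaw, Measure.integral_compProd Integrable.of_finite,
      integral_map (by fun_prop) (measurable_of_countable _).aestronglyMeasurable]
    simp only [integral_stepKernel G ϑ σA σD n f x₀]

end Prefix

/-! ### Discounted payoff: truncation, first-stage recursion, continuity -/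

section PlayValue

variable {S Θ : Type*} {A D : S → Type*}

lemma sum_mul_affine {X : Type*} [Fintype X] (α : stdSimplex ℝ X) (c k : ℝ) (h : X → ℝ) :
    ∑ a, α.1 a * (c + k * h a) = c + k * ∑ a, α.1 a * h a := by
  simp only [mul_add, Finset.sum_add_distrib, ← Finset.sum_mul, sum_eq_one, one_mul,
    Finset.mul_sum, mul_left_comm]

lemma actionAvg_affine {X Y : Type*} [Fintype X] [Fintype Y] (α : stdSimplex ℝ X)
    (δ : stdSimplex ℝ Y) (c k : ℝ) (h : X → Y → ℝ) :
    (actionAvg α δ fun a d => c + k * h a d) = c + k * actionAvg α δ h := by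
  simp only [actionAvg_eq, sum_mul_affine]

lemma continuous_shift {Z : S → Type*} [∀ s, TopologicalSpace (Z s)] (x : Stage A D) :
    Continuous (shift x : (List (Stage A D) → (s : S) → Z s) → _) :=
  continuous_pi fun l => continuous_apply (x :: l)

lemma continuous_actionAvg {P X Y : Type*} [TopologicalSpace P] [Fintype X] [Fintype Y]
    {α : P → stdSimplex ℝ X} {δ : P → stdSimplex ℝ Y} {h : P → X → Y → ℝ}
    (hα : Continuous α) (hδ : Continuous δ) (hh : ∀ a d, Continuous fun p => h p a d) :
    Continuous fun p => actionAvg (α p) (δ p) (h p) := by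
  unfold actionAvg
  refine continuous_finsetSum _ fun a _ => continuous_finsetSum _ fun d _ => ?_
  exact (((continuous_apply a).comp (continuous_subtype_val.comp hα)).mul
    ((continuous_apply d).comp (continuous_subtype_val.comp hδ))).mul (hh a d)

lemma pastList_frestrictLe_succ' (n : ℕ) (ω : ℕ → Stage A D) :
    pastList (Preorder.frestrictLe (π := fun _ => Stage A D) (n + 1) ω) =
      ω 0 :: pastList (Preorder.frestrictLe (π := fun _ => Stage A D) n fun k => ω (k + 1)) := by
  rw [pastList, List.ofFn_succ]
  rfl

variable [Fintype S]

/-- The discounted reward accumulated along a finite list of stages. -/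
noncomputable def Game.listReward (G : Game S Θ A D) (ϑ : Θ) : List (Stage A D) → ℝ
  | [] => 0
  | [_] => 0
  | x :: y :: l => G.R x.state x.att x.dfn y.state ϑ + G.γ * G.listReward ϑ (y :: l)

lemma Game.listReward_pastList (G : Game S Θ A D) (ϑ : Θ) (n : ℕ) (ω : ℕ → Stage A D) :
    G.listReward ϑ (pastList (Preorder.frestrictLe (π := fun _ => Stage A D) n ω)) =
      ∑ t ∈ Finset.range n,
        G.γ ^ t * G.R (ω t).state (ω t).att (ω t).dfn (ω (t + 1)).state ϑ := by
  induction n generalizing ω with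
  | zero => rfl
  | succ n ih =>
    have h : G.listReward ϑ (pastList (Preorder.frestrictLe (π := fun _ => Stage A D) (n + 1) ω)) =
        G.R (ω 0).state (ω 0).att (ω 0).dfn (ω 1).state ϑ + G.γ * G.listReward ϑ
          (pastList (Preorder.frestrictLe (π := fun _ => Stage A D) n fun k => ω (k + 1))) := by
      rw [pastList_frestrictLe_succ']
      cases n with
      | zero => rfl
      | succ m =>
        rw [pastList_frestrictLe_succ']
        rfl
    rw [h, ih, Finset.sum_range_succ', Finset.mul_sum, pow_zero, one_mul, add_comm]
    congr 1
    refine Finset.sum_congr rfl fun t _ => ?_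
    rw [pow_succ']
    ring

lemma tendsto_geometric_bound (G : Game S Θ A D) (C : ℝ) :
    Filter.Tendsto (fun n : ℕ => C * G.γ ^ n / (1 - G.γ)) Filter.atTop (nhds 0) := by
  simpa using ((tendsto_pow_atTop_nhds_zero_of_lt_one G.γ_nonneg G.γ_lt_one).const_mul
    C).div_const (1 - G.γ)

lemma abs_discounted_reward_le {G : Game S Θ A D} {C : ℝ}
    (hC : ∀ s a d s' ϑ, |G.R s a d s' ϑ| ≤ C) (ϑ : Θ)
    (ω : ℕ → Stage A D) (t : ℕ) :
    |G.γ ^ t * G.R (ω t).state (ω t).att (ω t).dfn (ω (t + 1)).state ϑ| ≤ C * G.γ ^ t := by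
  rw [abs_mul, abs_of_nonneg (pow_nonneg G.γ_nonneg t), mul_comm]
  exact mul_le_mul_of_nonneg_right (hC _ _ _ _ _) (pow_nonneg G.γ_nonneg t)

lemma tendsto_listReward {G : Game S Θ A D} {C : ℝ}
    (hC : ∀ s a d s' ϑ, |G.R s a d s' ϑ| ≤ C) (ϑ : Θ)
    (ω : ℕ → Stage A D) :
    Filter.Tendsto (fun n => G.listReward ϑ
      (pastList (Preorder.frestrictLe (π := fun _ => Stage A D) n ω))) Filter.atTop
      (nhds (G.discountedReward ϑ ω)) := by
  simp only [G.listReward_pastList]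
  refine (Summable.hasSum ?_).tendsto_sum_nat
  exact Summable.of_norm_bounded
    ((summable_geometric_of_lt_one G.γ_nonneg G.γ_lt_one).mul_left C)
    (abs_discounted_reward_le hC ϑ ω)

/-- Tail of a geometric series; the bound is uniform in the play, hence later in the strategies. -/
lemma abs_listReward_sub_le {G : Game S Θ A D} {C : ℝ}
    (hC : ∀ s a d s' ϑ, |G.R s a d s' ϑ| ≤ C) (ϑ : Θ)
    (ω : ℕ → Stage A D) (n : ℕ) :
    |G.listReward ϑ (pastList (Preorder.frestrictLe (π := fun _ => Stage A D) n ω)) -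
      G.discountedReward ϑ ω| ≤ C * G.γ ^ n / (1 - G.γ) := by
  refine dist_le_of_le_geometric_of_tendsto G.γ C G.γ_lt_one (fun k => ?_)
    (tendsto_listReward hC ϑ ω) n
  rw [G.listReward_pastList, G.listReward_pastList, Finset.sum_range_succ, dist_comm,
    Real.dist_eq, add_sub_cancel_left]
  exact abs_discounted_reward_le hC ϑ ω k

lemma abs_discountedReward_le {G : Game S Θ A D} {C : ℝ}
    (hC : ∀ s a d s' ϑ, |G.R s a d s' ϑ| ≤ C) (ϑ : Θ)
    (ω : ℕ → Stage A D) : |G.discountedReward ϑ ω| ≤ C / (1 - G.γ) := by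
  simpa [G.listReward_pastList] using abs_listReward_sub_le hC ϑ ω 0

variable [∀ s, Fintype (A s)] [∀ s, Fintype (D s)]

lemma Game.prefixExp_affine (G : Game S Θ A D) (ϑ : Θ) (c k : ℝ) (n : ℕ) (s : S)
    (σA : AttackerStrategy Θ A D) (σD : DefenderStrategy A D) {f g : List (Stage A D) → ℝ}
    (h : ∀ x l, x.state = s → f (x :: l) = c + k * g (x :: l)) :
    G.prefixExp ϑ n s σA σD f = c + k * G.prefixExp ϑ n s σA σD g := by
  induction n generalizing s σA σD f g with
  | zero =>
    rw [Game.prefixExp, Game.prefixExp, ← actionAvg_affine]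
    congr 1
    ext a d
    exact h _ _ rfl
  | succ n ih =>
    rw [Game.prefixExp, Game.prefixExp, ← actionAvg_affine]
    congr 1
    ext a d
    rw [← sum_mul_affine]
    refine Finset.sum_congr rfl fun s' _ => ?_
    rw [ih s' _ _ (g := fun l => g (⟨s, a, d⟩ :: l)) fun x l _ => h ⟨s, a, d⟩ (x :: l) rfl]

/-- The expected discounted reward of the first `n` transitions. -/
noncomputable def Game.finValue (G : Game S Θ A D) (n : ℕ) (s : S) (ϑ : Θ)
    (σA : AttackerStrategy Θ A D) (σD : DefenderStrategy A D) : ℝ :=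
  G.prefixExp ϑ n s σA σD (G.listReward ϑ)

lemma Game.finValue_zero (G : Game S Θ A D) (s : S) (ϑ : Θ)
    (σA : AttackerStrategy Θ A D) (σD : DefenderStrategy A D) :
    G.finValue 0 s ϑ σA σD = 0 := by
  simp [Game.finValue, Game.prefixExp, Game.listReward, actionAvg]

lemma Game.finValue_succ (G : Game S Θ A D) (n : ℕ) (s : S) (ϑ : Θ)
    (σA : AttackerStrategy Θ A D) (σD : DefenderStrategy A D) :
    G.finValue (n + 1) s ϑ σA σD =
      actionAvg (σA [] s ϑ) (σD [] s) fun a d => ∑ s', (G.T s a d).1 s' *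
        (G.R s a d s' ϑ +
          G.γ * G.finValue n s' ϑ (shift ⟨s, a, d⟩ σA) (shift ⟨s, a, d⟩ σD)) := by
  rw [Game.finValue, Game.prefixExp]
  congr 1
  ext a d
  refine Finset.sum_congr rfl fun s' _ => ?_
  rw [Game.finValue, G.prefixExp_affine ϑ (G.R s a d s' ϑ) G.γ]
  rintro x l rfl
  rfl

lemma Game.continuous_finValue (G : Game S Θ A D) (n : ℕ) (s : S) (ϑ : Θ) :
    Continuous fun p : AttackerStrategy Θ A D × DefenderStrategy A D =>
      G.finValue n s ϑ p.1 p.2 := by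
  induction n generalizing s with
  | zero => simpa only [Game.finValue_zero] using continuous_const
  | succ n ih =>
    simp only [Game.finValue_succ]
    refine continuous_actionAvg (by fun_prop) (by fun_prop) fun a d => ?_
    refine continuous_finsetSum _ fun s' _ => continuous_const.mul
      (continuous_const.add (continuous_const.mul ?_))
    exact (ih s').comp (((continuous_shift _).comp continuous_fst).prodMk
      ((continuous_shift _).comp continuous_snd))

/-- The expected discounted reward when `s₀ = s` and the intent parameter is `ϑ`. -/
noncomputable def Game.playValue (G : Game S Θ A D) (s : S) (ϑ : Θ)
    (σA : AttackerStrategy Θ A D) (σD : DefenderStrategy A D) : ℝ :=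
  ∫ ω, G.discountedReward ϑ ω ∂(G.playLaw s ϑ σA σD)

lemma Game.exists_abs_reward_le [Finite Θ] (G : Game S Θ A D) :
    ∃ C, ∀ s a d s' ϑ, |G.R s a d s' ϑ| ≤ C := by
  obtain ⟨C, hC⟩ := (Set.finite_range fun p : Stage A D × S × Θ =>
    |G.R p.1.state p.1.att p.1.dfn p.2.1 p.2.2|).bddAbove
  exact ⟨C, fun s a d s' ϑ => hC ⟨(⟨s, a, d⟩, s', ϑ), rfl⟩⟩

section Bounds

variable {G : Game S Θ A D} {C : ℝ}

lemma measurable_discountedReward (hC : ∀ s a d s' ϑ, |G.R s a d s' ϑ| ≤ C) (ϑ : Θ) :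
    Measurable (G.discountedReward ϑ) :=
  measurable_of_tendsto_metrizable
    (fun n => measurable_comp_pastList n (G.listReward ϑ))
    (tendsto_pi_nhds.2 (tendsto_listReward hC ϑ))

variable [∀ s, Nonempty (A s)] [∀ s, Nonempty (D s)]

lemma abs_finValue_sub_le (hC : ∀ s a d s' ϑ, |G.R s a d s' ϑ| ≤ C) (n : ℕ) (s : S) (ϑ : Θ)
    (σA : AttackerStrategy Θ A D) (σD : DefenderStrategy A D) :
    |G.finValue n s ϑ σA σD - G.playValue s ϑ σA σD| ≤ C * G.γ ^ n / (1 - G.γ) := by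
  have hi : Integrable (G.discountedReward ϑ) (G.playLaw s ϑ σA σD) :=
    Integrable.of_bound (measurable_discountedReward hC ϑ).aestronglyMeasurable _
      (Filter.Eventually.of_forall (abs_discountedReward_le hC ϑ))
  have hd := abs_listReward_sub_le hC ϑ (n := n)
  have hj : Integrable (fun ω => G.listReward ϑ
      (pastList (Preorder.frestrictLe (π := fun _ => Stage A D) n ω))) (G.playLaw s ϑ σA σD) := by
    -- The truncated reward is the bounded truncation error plus the integrable full reward.
    have := (Integrable.of_bound (μ := G.playLaw s ϑ σA σD)
      (((measurable_comp_pastList n (G.listReward ϑ)).sub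
        (measurable_discountedReward hC ϑ)).aestronglyMeasurable) _
      (Filter.Eventually.of_forall hd)).add hi
    refine this.congr (Filter.Eventually.of_forall fun ω => ?_)
    simp
  rw [Game.finValue, ← G.integral_pastList ⟨s, Classical.arbitrary _, Classical.arbitrary _⟩,
    Game.playValue, ← integral_sub hj hi]
  have := norm_integral_le_of_norm_le_const (μ := G.playLaw s ϑ σA σD)
    (f := fun ω => G.listReward ϑ (pastList
      (Preorder.frestrictLe (π := fun _ => Stage A D) n ω)) - G.discountedReward ϑ ω)
    (Filter.Eventually.of_forall hd)
  simpa using this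

lemma abs_playValue_le (hC : ∀ s a d s' ϑ, |G.R s a d s' ϑ| ≤ C) (s : S) (ϑ : Θ)
    (σA : AttackerStrategy Θ A D) (σD : DefenderStrategy A D) :
    |G.playValue s ϑ σA σD| ≤ C / (1 - G.γ) := by
  simpa [Game.finValue_zero] using abs_finValue_sub_le hC 0 s ϑ σA σD

end Bounds

variable [Finite Θ] [∀ s, Nonempty (A s)] [∀ s, Nonempty (D s)]

lemma Game.tendsto_finValue (G : Game S Θ A D) (s : S) (ϑ : Θ)
    (σA : AttackerStrategy Θ A D) (σD : DefenderStrategy A D) :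
    Filter.Tendsto (fun n => G.finValue n s ϑ σA σD) Filter.atTop
      (nhds (G.playValue s ϑ σA σD)) := by
  obtain ⟨C, hC⟩ := G.exists_abs_reward_le
  rw [tendsto_iff_dist_tendsto_zero]
  exact squeeze_zero (fun _ => dist_nonneg) (fun n => abs_finValue_sub_le hC n s ϑ σA σD)
    (tendsto_geometric_bound G C)

/-- Limit of the finite-horizon recursion `Game.finValue_succ`, so the infinite play measure need
not be disintegrated at time 0. -/
lemma Game.playValue_eq (G : Game S Θ A D) (s : S) (ϑ : Θ)
    (σA : AttackerStrategy Θ A D) (σD : DefenderStrategy A D) :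
    G.playValue s ϑ σA σD =
      actionAvg (σA [] s ϑ) (σD [] s) fun a d => ∑ s', (G.T s a d).1 s' *
        (G.R s a d s' ϑ +
          G.γ * G.playValue s' ϑ (shift ⟨s, a, d⟩ σA) (shift ⟨s, a, d⟩ σD)) := by
  refine tendsto_nhds_unique
    ((Filter.tendsto_add_atTop_iff_nat 1).2 (G.tendsto_finValue s ϑ σA σD)) ?_
  simp only [Game.finValue_succ, actionAvg]
  refine tendsto_finsetSum _ fun a _ => tendsto_finsetSum _ fun d _ => Filter.Tendsto.const_mul _
    (tendsto_finsetSum _ fun s' _ => Filter.Tendsto.const_mul _ (Filter.Tendsto.const_add _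
      (Filter.Tendsto.const_mul _ (G.tendsto_finValue _ _ _ _))))

lemma Game.continuous_playValue (G : Game S Θ A D) (s : S) (ϑ : Θ) :
    Continuous fun p : AttackerStrategy Θ A D × DefenderStrategy A D =>
      G.playValue s ϑ p.1 p.2 := by
  obtain ⟨C, hC⟩ := G.exists_abs_reward_le
  have h : TendstoUniformly (fun n (p : AttackerStrategy Θ A D × DefenderStrategy A D) =>
      G.finValue n s ϑ p.1 p.2) (fun p => G.playValue s ϑ p.1 p.2) Filter.atTop := by
    rw [Metric.tendstoUniformly_iff]
    intro ε hε
    filter_upwards [(tendsto_geometric_bound G C).eventually_lt_const hε] with n hn p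
    rw [dist_comm]
    exact (abs_finValue_sub_le hC n s ϑ p.1 p.2).trans_lt hn
  exact h.continuous (Filter.Frequently.of_forall fun n => G.continuous_finValue n s ϑ)

end PlayValue

/-! ### Attained maximin values -/

section MaxMin

variable {X Y : Type*} {f g : X → Y → ℝ} {c c' : ℝ}

lemma IsMaxMin.exists_le (h : IsMaxMin f c) (x : X) : ∃ y, f x y ≤ c := by
  obtain ⟨m, hm, hc⟩ := h
  obtain ⟨y, hy⟩ := (hm x).1
  exact ⟨y, hy.trans_le (hc.2 ⟨x, rfl⟩)⟩

lemma IsMaxMin.exists_ge (h : IsMaxMin f c) : ∃ x, ∀ y, c ≤ f x y := by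
  obtain ⟨m, hm, hc⟩ := h
  obtain ⟨x, hx⟩ := hc.1
  exact ⟨x, fun y => hx.symm.trans_le ((hm x).2 ⟨y, rfl⟩)⟩

lemma maxMin_le_add {ε : ℝ} (hf : ∃ x, ∀ y, c ≤ f x y) (hg : ∀ x, ∃ y, g x y ≤ c')
    (h : ∀ x y, f x y ≤ g x y + ε) : c ≤ c' + ε := by
  obtain ⟨x, hx⟩ := hf
  obtain ⟨y, hy⟩ := hg x
  linarith [hx y, h x y]

lemma IsMaxMin.eq_of_forall (h : IsMaxMin f c) (h₁ : ∀ x, ∃ y, f x y ≤ c')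
    (h₂ : ∃ x, ∀ y, c' ≤ f x y) : c = c' := by
  refine le_antisymm ?_ ?_
  · simpa using maxMin_le_add (ε := 0) h.exists_ge h₁ fun _ _ => by simp
  · simpa using maxMin_le_add (ε := 0) h₂ h.exists_le fun _ _ => by simp

/-- The maximin of a continuous function on nonempty compact spaces is attained. -/
theorem isMaxMin_iSup_iInf [TopologicalSpace X] [TopologicalSpace Y] [CompactSpace X]
    [CompactSpace Y] [Nonempty X] [Nonempty Y]
    (hf : Continuous fun p : X × Y => f p.1 p.2) : IsMaxMin f (⨆ x, ⨅ y, f x y) := by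
  have hb : ∀ x, BddBelow (Set.range (f x)) := fun x =>
    (isCompact_range (hf.comp (Continuous.prodMk_right x))).bddBelow
  -- An infimum of continuous functions is upper semicontinuous, which suffices for a maximum on a
  -- compact space.
  have hu : UpperSemicontinuous fun x => ⨅ y, f x y :=
    upperSemicontinuous_ciInf hb fun y =>
      (hf.comp (Continuous.prodMk_left y)).upperSemicontinuous
  refine ⟨fun x => ⨅ y, f x y, fun x => ⟨?_, ?_⟩, ?_⟩
  · exact (isCompact_range (hf.comp (Continuous.prodMk_right x))).sInf_mem
      (Set.range_nonempty _)
  · rintro _ ⟨y, rfl⟩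
    exact ciInf_le (hb x) y
  · obtain ⟨x, -, hx⟩ := UpperSemicontinuousOn.exists_isMaxOn Set.univ_nonempty isCompact_univ
      (hu.upperSemicontinuousOn Set.univ)
    have hg : IsGreatest (Set.range fun x => ⨅ y, f x y) (⨅ y, f x y) :=
      ⟨⟨x, rfl⟩, by rintro _ ⟨x', rfl⟩; exact hx (Set.mem_univ x')⟩
    have : ⨆ x, ⨅ y, f x y = ⨅ y, f x y := hg.csSup_eq
    rwa [this]

end MaxMin

/-! ### Unnormalised beliefs -/

section Weighted

variable {S Θ : Type*} {A D : S → Type*} [Fintype S] [Fintype Θ]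
  [∀ s, Fintype (A s)] [∀ s, Fintype (D s)]

/-- The payoff when the intent parameter carries the weights `w`, which need not add up to `1`. -/
noncomputable def Game.weightedPayoff (G : Game S Θ A D) (s : S) (w : Θ → ℝ)
    (σA : AttackerStrategy Θ A D) (σD : DefenderStrategy A D) : ℝ :=
  ∑ ϑ, w ϑ * G.playValue s ϑ σA σD

/-- The maximin of the payoff when the intent parameter carries the weights `w`. -/
noncomputable def Game.weightedValue (G : Game S Θ A D) (s : S) (w : Θ → ℝ) : ℝ :=
  ⨆ σA : AttackerStrategy Θ A D, ⨅ σD : DefenderStrategy A D, G.weightedPayoff s w σA σD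

/-- The weights of the intent parameters that remain once the action `a` has been observed. -/
def actionWeight {X : Type*} [Fintype X] (w : Θ → ℝ) (π : Θ → stdSimplex ℝ X) (a : X) : Θ → ℝ :=
  fun ϑ => w ϑ * (π ϑ).1 a

variable [∀ s, Nonempty (A s)] [∀ s, Nonempty (D s)]

lemma Game.isMaxMin_weightedValue (G : Game S Θ A D) (s : S) (w : Θ → ℝ) :
    IsMaxMin (G.weightedPayoff s w) (G.weightedValue s w) :=
  isMaxMin_iSup_iInf (continuous_finsetSum _ fun ϑ _ =>
    continuous_const.mul (G.continuous_playValue s ϑ))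

lemma Game.weightedValue_smul (G : Game S Θ A D) (s : S) (w : Θ → ℝ) {t : ℝ} (ht : 0 ≤ t) :
    G.weightedValue s (fun ϑ => t * w ϑ) = t * G.weightedValue s w := by
  have h : ∀ σA σD, G.weightedPayoff s (fun ϑ => t * w ϑ) σA σD =
      t * G.weightedPayoff s w σA σD := fun σA σD => by
    simp only [Game.weightedPayoff, Finset.mul_sum, mul_assoc]
  refine (G.isMaxMin_weightedValue s _).eq_of_forall (fun σA => ?_) ?_
  · obtain ⟨σD, hσ⟩ := (G.isMaxMin_weightedValue s w).exists_le σA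
    exact ⟨σD, by rw [h]; exact mul_le_mul_of_nonneg_left hσ ht⟩
  · obtain ⟨σA, hσ⟩ := (G.isMaxMin_weightedValue s w).exists_ge
    exact ⟨σA, fun σD => by rw [h]; exact mul_le_mul_of_nonneg_left (hσ σD) ht⟩

/-- Payoffs are bounded by `C / (1 - G.γ)`, so the maximin is Lipschitz in the weights for the ℓ¹
distance. -/
lemma Game.continuous_weightedValue (G : Game S Θ A D) (s : S) :
    Continuous (G.weightedValue s) := by
  obtain ⟨C, hC⟩ := G.exists_abs_reward_le
  have h : ∀ w w', G.weightedValue s w ≤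
      G.weightedValue s w' + ∑ ϑ, |w ϑ - w' ϑ| * (C / (1 - G.γ)) := fun w w' => by
    refine maxMin_le_add (G.isMaxMin_weightedValue s w).exists_ge
      (G.isMaxMin_weightedValue s w').exists_le fun σA σD => ?_
    rw [Game.weightedPayoff, Game.weightedPayoff, ← Finset.sum_add_distrib]
    refine Finset.sum_le_sum fun ϑ _ => ?_
    have h1 := (le_abs_self _).trans_eq (abs_mul (w ϑ - w' ϑ) (G.playValue s ϑ σA σD))
    have h2 := mul_le_mul_of_nonneg_left (abs_playValue_le hC s ϑ σA σD)
      (abs_nonneg (w ϑ - w' ϑ))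
    linarith
  refine continuous_iff_continuousAt.2 fun w => tendsto_iff_dist_tendsto_zero.2 ?_
  have hc : Continuous fun w' : Θ → ℝ => ∑ ϑ, |w' ϑ - w ϑ| * (C / (1 - G.γ)) := by fun_prop
  refine squeeze_zero (fun _ => dist_nonneg) (fun w' => ?_)
    (by simpa using hc.tendsto w)
  have h1 := h w' w
  have h2 := h w w'
  simp only [abs_sub_comm (w _) (w' _)] at h2
  rw [Real.dist_eq, abs_le]
  constructor <;> linarith

/-- The defender's move and the transition do not depend on `ϑ`, so their probabilities leave the
sum over `ϑ`, and the attacker's are absorbed into the weights. -/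
lemma Game.weightedPayoff_eq (G : Game S Θ A D) (s : S) (w : Θ → ℝ)
    (σA : AttackerStrategy Θ A D) (σD : DefenderStrategy A D) :
    G.weightedPayoff s w σA σD =
      ∑ a, ∑ d, (σD [] s).1 d * ∑ s', (G.T s a d).1 s' *
        (∑ ϑ, actionWeight w (σA [] s) a ϑ * G.R s a d s' ϑ +
          G.γ * G.weightedPayoff s' (actionWeight w (σA [] s) a)
            (shift ⟨s, a, d⟩ σA) (shift ⟨s, a, d⟩ σD)) := by
  simp only [Game.weightedPayoff, actionWeight]
  conv_lhs => enter [2, ϑ]; rw [G.playValue_eq]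
  simp only [actionAvg, Finset.mul_sum, ← Finset.sum_add_distrib]
  rw [Finset.sum_comm]
  refine Finset.sum_congr rfl fun a _ => ?_
  rw [Finset.sum_comm]
  refine Finset.sum_congr rfl fun d _ => ?_
  rw [Finset.sum_comm]
  refine Finset.sum_congr rfl fun s' _ => Finset.sum_congr rfl fun ϑ _ => ?_
  ring

lemma Game.sum_mul_value_posterior (G : Game S Θ A D) (π : AttackerOneStage Θ A) (s : S)
    (b : stdSimplex ℝ Θ) (a : A s) (s' : S) :
    (∑ ϑ, b.1 ϑ * (π s ϑ).1 a) * G.value s' (posterior π s b a) =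
      G.weightedValue s' (actionWeight b.1 (π s) a) := by
  have h0 : ∀ ϑ, 0 ≤ b.1 ϑ * (π s ϑ).1 a := fun ϑ =>
    mul_nonneg (coe_nonneg _ _) (coe_nonneg _ _)
  have hv : G.value s' (posterior π s b a) = G.weightedValue s' (posterior π s b a).1 := rfl
  rw [hv, ← G.weightedValue_smul s' _ (Finset.sum_nonneg fun ϑ _ => h0 ϑ)]
  congr 1
  ext ϑ
  have hcomm : ∑ ϑ', (π s ϑ').1 a * b.1 ϑ' = ∑ ϑ', b.1 ϑ' * (π s ϑ').1 a :=
    Finset.sum_congr rfl fun _ _ => mul_comm _ _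
  rw [posterior]
  split_ifs with h
  -- If `a` has probability zero, every new weight vanishes, so the default posterior is irrelevant.
  · rw [hcomm] at h
    have := (Finset.sum_eq_zero_iff_of_nonneg fun ϑ _ => h0 ϑ).1 h ϑ (Finset.mem_univ ϑ)
    rw [h, zero_mul, actionWeight, this]
  · simp only [actionWeight]
    rw [hcomm] at h ⊢
    rw [mul_div_cancel₀ _ h, mul_comm]

lemma Game.stagePayoff_value_eq (G : Game S Θ A D) (s : S) (b : stdSimplex ℝ Θ)
    (πA : AttackerOneStage Θ A) (πD : DefenderOneStage D) :
    G.stagePayoff G.value s b πA πD =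
      ∑ a, ∑ d, (πD s).1 d * ∑ s', (G.T s a d).1 s' *
        (∑ ϑ, actionWeight b.1 (πA s) a ϑ * G.R s a d s' ϑ +
          G.γ * G.weightedValue s' (actionWeight b.1 (πA s) a)) := by
  simp only [← G.sum_mul_value_posterior, Game.stagePayoff, Game.instReward, Game.contValue,
    actionWeight, Finset.mul_sum, Finset.sum_mul, ← Finset.sum_add_distrib]
  refine Finset.sum_congr rfl fun a _ => Finset.sum_congr rfl fun d _ =>
    Finset.sum_congr rfl fun s' _ => Finset.sum_congr rfl fun ϑ _ => ?_
  ring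

/-- The posterior may jump where the probability of an action vanishes; in the weighted form the
stage payoff is visibly continuous. -/
lemma Game.isMaxMin_backup_value (G : Game S Θ A D) (s : S) (b : stdSimplex ℝ Θ) :
    IsMaxMin (G.stagePayoff G.value s b) (G.backup G.value s b) := by
  refine isMaxMin_iSup_iInf ?_
  simp only [G.stagePayoff_value_eq]
  have hw : ∀ a ϑ, Continuous fun p : AttackerOneStage Θ A × DefenderOneStage D =>
      actionWeight b.1 (p.1 s) a ϑ := fun a ϑ => by
    have : Continuous fun p : AttackerOneStage Θ A × DefenderOneStage D => p.1 s ϑ := by fun_prop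
    exact continuous_const.mul ((continuous_apply a).comp (continuous_subtype_val.comp this))
  have hd : ∀ d, Continuous fun p : AttackerOneStage Θ A × DefenderOneStage D =>
      (p.2 s).1 d := fun d => by
    have : Continuous fun p : AttackerOneStage Θ A × DefenderOneStage D => p.2 s := by fun_prop
    exact (continuous_apply d).comp (continuous_subtype_val.comp this)
  refine continuous_finsetSum _ fun a _ => continuous_finsetSum _ fun d _ =>
    (hd d).mul (continuous_finsetSum _ fun s' _ => continuous_const.mul (Continuous.add ?_ ?_))
  · exact continuous_finsetSum _ fun ϑ _ => (hw a ϑ).mul continuous_const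
  · exact continuous_const.mul ((G.continuous_weightedValue s').comp (continuous_pi (hw a)))

end Weighted

/-! ### Gluing continuation strategies -/

section Glue

variable {S Θ : Type*} {A D : S → Type*} {Z : S → Type*}

/-- The strategy that starts with `π` and goes on with `τ x s` after the first stage `x` when the
second state is `s`. -/
def glue (π : (s : S) → Z s) (τ : Stage A D → S → List (Stage A D) → (s : S) → Z s) :
    List (Stage A D) → (s : S) → Z s
  | [], s => π s
  | [x], s => τ x s [] s
  | x :: y :: l, s => τ x y.state (y :: l) s

variable [Fintype S] [Fintype Θ] [∀ s, Fintype (A s)] [∀ s, Fintype (D s)]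
  [∀ s, Nonempty (A s)] [∀ s, Nonempty (D s)]

/-- Only histories starting at `s` matter. A glued strategy picks its continuation from the second
state, so it agrees with `τ x s` on exactly such histories. -/
lemma Game.playValue_congr (G : Game S Θ A D) (s : S) (ϑ : Θ)
    {σA σA' : AttackerStrategy Θ A D} {σD σD' : DefenderStrategy A D}
    (hA : σA [] s = σA' [] s) (hA' : ∀ a d, shift ⟨s, a, d⟩ σA = shift ⟨s, a, d⟩ σA')
    (hD : σD [] s = σD' [] s) (hD' : ∀ a d, shift ⟨s, a, d⟩ σD = shift ⟨s, a, d⟩ σD') :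
    G.playValue s ϑ σA σD = G.playValue s ϑ σA' σD' := by
  rw [G.playValue_eq, G.playValue_eq s ϑ σA']
  simp only [hA, hA', hD, hD']

lemma Game.weightedPayoff_glue_attacker (G : Game S Θ A D) (s : S) (w : Θ → ℝ) (x : Stage A D)
    (π : AttackerOneStage Θ A) (τ : Stage A D → S → AttackerStrategy Θ A D)
    (σD : DefenderStrategy A D) :
    G.weightedPayoff s w (shift x (glue π τ)) σD = G.weightedPayoff s w (τ x s) σD :=
  Finset.sum_congr rfl fun ϑ _ => congrArg (w ϑ * ·)
    (G.playValue_congr s ϑ rfl (fun _ _ => rfl) rfl fun _ _ => rfl)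

lemma Game.weightedPayoff_glue_defender (G : Game S Θ A D) (s : S) (w : Θ → ℝ) (x : Stage A D)
    (π : DefenderOneStage D) (τ : Stage A D → S → DefenderStrategy A D)
    (σA : AttackerStrategy Θ A D) :
    G.weightedPayoff s w σA (shift x (glue π τ)) = G.weightedPayoff s w σA (τ x s) :=
  Finset.sum_congr rfl fun ϑ _ => congrArg (w ϑ * ·)
    (G.playValue_congr s ϑ rfl (fun _ _ => rfl) rfl fun _ _ => rfl)

/-- The value satisfies the recursive formula. -/
theorem Game.value_eq_backup (G : Game S Θ A D) (s : S) (b : stdSimplex ℝ Θ) :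
    G.value s b = G.backup G.value s b := by
  refine (G.isMaxMin_weightedValue s b.1).eq_of_forall (fun σA => ?_) ?_
  -- The defender replies to a known `σA`: first in the stage game to `σA []`, then to each
  -- continuation `shift x σA`.
  · obtain ⟨πD, hπ⟩ := (G.isMaxMin_backup_value s b).exists_le (σA [])
    choose τ hτ using fun (x : Stage A D) s' =>
      (G.isMaxMin_weightedValue s' (actionWeight b.1 (σA [] x.state) x.att)).exists_le (shift x σA)
    refine ⟨glue πD τ, le_trans ?_ hπ⟩
    rw [G.weightedPayoff_eq, G.stagePayoff_value_eq]
    simp only [G.weightedPayoff_glue_defender]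
    refine Finset.sum_le_sum fun a _ => Finset.sum_le_sum fun d _ =>
      mul_le_mul_of_nonneg_left (Finset.sum_le_sum fun s' _ =>
        mul_le_mul_of_nonneg_left ?_ (coe_nonneg _ _)) (coe_nonneg _ _)
    have := mul_le_mul_of_nonneg_left (hτ ⟨s, a, d⟩ s') G.γ_nonneg
    linarith
  -- The attacker's continuations are optimal for the weights left by `πA`, hence guarantee the
  -- value against every `σD`.
  · obtain ⟨πA, hπ⟩ := (G.isMaxMin_backup_value s b).exists_ge
    choose τ hτ using fun (x : Stage A D) s' =>
      (G.isMaxMin_weightedValue s' (actionWeight b.1 (πA x.state) x.att)).exists_ge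
    refine ⟨glue πA τ, fun σD => (hπ (σD [])).trans ?_⟩
    rw [G.weightedPayoff_eq, G.stagePayoff_value_eq]
    simp only [G.weightedPayoff_glue_attacker]
    refine Finset.sum_le_sum fun a _ => Finset.sum_le_sum fun d _ =>
      mul_le_mul_of_nonneg_left (Finset.sum_le_sum fun s' _ =>
        mul_le_mul_of_nonneg_left ?_ (coe_nonneg _ _)) (coe_nonneg _ _)
    have := mul_le_mul_of_nonneg_left (hτ ⟨s, a, d⟩ s' (shift ⟨s, a, d⟩ σD)) G.γ_nonneg
    simp only [glue]
    linarith

end Glue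

end NCIRL

theorem proposition1 {S Θ : Type*} {A D : S → Type*} [Fintype S] [Fintype Θ]
    [∀ s, Fintype (A s)] [∀ s, Fintype (D s)] [∀ s, Nonempty (A s)] [∀ s, Nonempty (D s)]
    (G : NCIRL.Game S Θ A D) :
    -- the primal value is a genuine max-min over behavioral strategies
    (∀ (s : S) (b : stdSimplex ℝ Θ), NCIRL.IsMaxMin (G.payoff s b) (G.value s b)) ∧
    -- it satisfies the recursive formula, where max and min are attained, too
    (∀ (s : S) (b : stdSimplex ℝ Θ),
      G.value s b = G.backup G.value s b ∧
      NCIRL.IsMaxMin (G.stagePayoff G.value s b) (G.backup G.value s b)) := by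
  exact ⟨fun s b => G.isMaxMin_weightedValue s b.1,
    fun s b => ⟨G.value_eq_backup s b, G.isMaxMin_backup_value s b⟩⟩
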